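/- Let $H$ be a separable complex Hilbert space, $J$ a complex conjugation on $H$ (an antiunitary involution), and $Q$ an orthogonal projection on $H$ commuting with $J$; put $Q^\perp=1-Q$. For a complex Hilbert space $K$ with complex conjugation $J_K$, let $\mathrm{CAR}(K,J_K)$ be the selfdual CAR algebra, i.e. the universal unital C*-algebra generated by operators $B(f)$, $f\in K$, depending complex linearly on $f$, with $B(f)^*=B(J_Kf)$ and $B(f)B(h)+B(h)B(f)=\langle J_Kf,h\rangle 1$ (inner products are linear in the second argument). On $H_Q:=H\oplus Q^\perp H$ consider the complex conjugation $J_Q(f\oplus h):=(QJf+Jh)\oplus Q^\perp Jf$, and in $\mathrm{CAR}(H_Q,J_Q)$ put $G(f):=B(f\oplus 0)$ for $f\in H$. The GAR algebra $\mathrm{GAR}(H,J,Q)$ is the norm-closed unital subalgebra of $\mathrm{CAR}(H_Q,J_Q)$ generated by all $G(f)$, $f\in H$. Its Grassmann part is the norm-closed unital subalgebra generated by the $G(h)$, $h\in Q^\perp H$, and the odd elements of the Grassmann part are the elements of the norm-closed linear span of all products of an odd number of such $G(h)$. Suppose that $Q$ has finite even rank $2n$ and that $Q^\perp$ has infinite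 rank. If $X\in\mathrm{GAR}(H,J,Q)$ satisfies $X\lambda_1\cdots\lambda_{2n}=0$ for all odd elements $\lambda_1,\dots,\lambda_{2n}$ of the Grassmann part, then $X=0$. Equivalently, the subspace of $\mathrm{GAR}(H,J,Q)$ consisting of all such $X$ is $\{0\}$. -/

import Mathlib

open scoped InnerProductSpace ENNReal

namespace GARAlgebra

universe u

/-- A complex conjugation on a complex inner product space: an antiunitary involution. -/
structure Conjugation (K : Type u) [NormedAddCommGroup K] [InnerProductSpace ℂ K] where
  toMap : K →ₛₗ[starRingEnd ℂ] K
  involutive : ∀ f, toMap (toMap f) = f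
  inner_map : ∀ f g, ⟪toMap f, toMap g⟫_ℂ = ⟪g, f⟫_ℂ

instance {K : Type u} [NormedAddCommGroup K] [InnerProductSpace ℂ K] :
    CoeFun (Conjugation K) (fun _ => K → K) := ⟨fun J => J.toMap⟩

section CAR

variable {K : Type u} [NormedAddCommGroup K] [InnerProductSpace ℂ K]

/-- A representation of the selfdual canonical anticommutation relations over `(K, J)` in a nonzero
unital C⋆-algebra: a complex linear map `B` with `B(f)* = B(Jf)` and
`B(f) B(h) + B(h) B(f) = ⟪Jf, h⟫ 1`. -/
structure CARRep (J : Conjugation K) where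
  carrier : Type u
  [cstar : CStarAlgebra carrier]
  [nontriv : Nontrivial carrier]
  field : K →ₗ[ℂ] carrier
  star_field : ∀ f, star (field f) = field (J f)
  anticomm : ∀ f h, field f * field h + field h * field f = algebraMap ℂ carrier ⟪J f, h⟫_ℂ

attribute [instance] CARRep.cstar CARRep.nontriv

theorem CARRep.norm_field_le {J : Conjugation K} (r : CARRep J) (f : K) :
    ‖r.field f‖ ≤ ‖f‖ := by
  let _ : PartialOrder r.carrier := CStarAlgebra.spectralOrder r.carrier
  have _ : StarOrderedRing r.carrier := CStarAlgebra.spectralOrderedRing r.carrier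
  have h1 : star (r.field f) * r.field f + r.field f * star (r.field f)
      = algebraMap ℂ r.carrier ⟪f, f⟫_ℂ := by
    rw [r.star_field, r.anticomm, J.involutive]
  have h2 : star (r.field f) * r.field f ≤ algebraMap ℂ r.carrier ⟪f, f⟫_ℂ := by
    rw [← h1]
    exact le_add_of_nonneg_right (mul_star_self_nonneg _)
  have h3 := CStarAlgebra.norm_le_norm_of_nonneg_of_le (star_mul_self_nonneg (r.field f)) h2
  rw [CStarRing.norm_star_mul_self, norm_algebraMap', inner_self_eq_norm_sq_to_K, norm_pow] at h3
  simp only [Complex.coe_algebraMap, Complex.norm_real, norm_norm] at h3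
  nlinarith [norm_nonneg f, norm_nonneg (r.field f)]

/-- The C⋆-algebra of bounded families indexed by all representations of the selfdual canonical
anticommutation relations, with the supremum norm. -/
abbrev CARProduct (J : Conjugation K) : Type (u + 1) :=
  lp (fun r : CARRep J => r.carrier) ∞

noncomputable instance (J : Conjugation K) : CStarAlgebra (CARProduct J) where

/-- The family of all `r.field f`. -/
noncomputable def universalField (J : Conjugation K) : K →ₗ[ℂ] CARProduct J where
  toFun f := ⟨fun r => r.field f, memℓp_infty ⟨‖f‖, by
    rintro _ ⟨r, rfl⟩
    exact r.norm_field_le f⟩⟩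
  map_add' f g := by
    apply Subtype.ext
    funext r
    exact map_add r.field f g
  map_smul' c f := by
    apply Subtype.ext
    funext r
    exact map_smul r.field c f

/-- Araki's selfdual CAR algebra over `(K, J)`, as the universal C⋆-algebra of the selfdual
canonical anticommutation relations: the C⋆-algebra generated by the fields inside the product of
all representations. -/
noncomputable def carSubalgebra (J : Conjugation K) : StarSubalgebra ℂ (CARProduct J) :=
  (StarAlgebra.adjoin ℂ (Set.range (universalField J))).topologicalClosure

instance (J : Conjugation K) : IsClosed (carSubalgebra J : Set (CARProduct J)) :=
  StarSubalgebra.isClosed_topologicalClosure _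

/-- The CAR algebra `CAR(K, J)`. -/
abbrev CAR (J : Conjugation K) : Type (u + 1) := carSubalgebra J

noncomputable instance (J : Conjugation K) : CStarAlgebra (CAR J) :=
  StarSubalgebra.cstarAlgebra (carSubalgebra J)

/-- The field operators `B(f)` in the CAR algebra. -/
noncomputable def B (J : Conjugation K) : K →ₗ[ℂ] CAR J :=
  (universalField J).codRestrict (Subalgebra.toSubmodule (carSubalgebra J).toSubalgebra)
    (fun f => StarSubalgebra.le_topologicalClosure _
      (StarAlgebra.subset_adjoin ℂ _ (Set.mem_range_self f)))

theorem star_B (J : Conjugation K) (f : K) : star (B J f) = B J (J f) := by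
  apply Subtype.ext
  apply Subtype.ext
  funext r
  exact r.star_field f

theorem B_anticomm (J : Conjugation K) (f h : K) :
    B J f * B J h + B J h * B J f = algebraMap ℂ (CAR J) ⟪J f, h⟫_ℂ := by
  apply Subtype.ext
  apply Subtype.ext
  funext r
  exact r.anticomm f h

end CAR

section GAR

/-- The data `(H, J, Q)`: a complex conjugation `J` and an orthogonal projection `Q` on `H` that
commutes with `J`. -/
structure GARData (H : Type u) [NormedAddCommGroup H] [InnerProductSpace ℂ H]
    [CompleteSpace H] where
  J : Conjugation H
  Q : H →L[ℂ] H
  isStarProjection : IsStarProjection Q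
  commute : ∀ f, Q (J f) = J (Q f)

variable {H : Type u} [NormedAddCommGroup H] [InnerProductSpace ℂ H] [CompleteSpace H]

namespace GARData

/-- The subspace `QH`. -/
def rangeQ (D : GARData H) : Submodule ℂ H := LinearMap.range (D.Q : H →ₗ[ℂ] H)

/-- The complementary projection `Q^⊥ = 1 - Q`. -/
noncomputable def Qperp (D : GARData H) : H →L[ℂ] H := 1 - D.Q

/-- The subspace `Q^⊥ H`. -/
noncomputable def rangeQperp (D : GARData H) : Submodule ℂ H := LinearMap.range (D.Qperp : H →ₗ[ℂ] H)

theorem Q_Q (D : GARData H) (f : H) : D.Q (D.Q f) = D.Q f :=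
  congrArg (fun T : H →L[ℂ] H => T f) D.isStarProjection.isIdempotentElem

theorem Qperp_apply (D : GARData H) (f : H) : D.Qperp f = f - D.Q f := rfl

theorem Q_rangeQperp (D : GARData H) (h : D.rangeQperp) : D.Q (h : H) = 0 := by
  obtain ⟨_, f, rfl⟩ := h
  change D.Q (D.Qperp f) = 0
  rw [Qperp_apply, map_sub, Q_Q, sub_self]

theorem inner_Q (D : GARData H) (f g : H) : ⟪D.Q f, g⟫_ℂ = ⟪f, D.Q g⟫_ℂ := by
  have h := D.isStarProjection.isSelfAdjoint
  rw [ContinuousLinearMap.isSelfAdjoint_iff'] at h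
  rw [← ContinuousLinearMap.adjoint_inner_left, h]

/-- The Hilbert space `H_Q = H ⊕ Q^⊥ H`. -/
abbrev HQ (D : GARData H) : Type u := WithLp 2 (H × D.rangeQperp)

/-- `Q^⊥` as a map onto its range. -/
noncomputable def toPerp (D : GARData H) : H →ₗ[ℂ] D.rangeQperp :=
  (D.Qperp : H →ₗ[ℂ] H).rangeRestrict

theorem coe_toPerp (D : GARData H) (f : H) : (D.toPerp f : H) = f - D.Q f := rfl

/-- The complex conjugation `J_Q (f ⊕ h) = R_Q (Jf ⊕ Jh) = (QJf + Jh) ⊕ Q^⊥ Jf` on `H_Q`, where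
`R_Q (f ⊕ h) = (Qf + h) ⊕ Q^⊥ f`. -/
noncomputable def JQ (D : GARData H) : Conjugation D.HQ where
  toMap :=
    { toFun := fun x => WithLp.toLp 2 (D.Q (D.J x.fst) + D.J (x.snd : H), D.toPerp (D.J x.fst))
      map_add' := fun x y => by
        apply (WithLp.equiv 2 _).injective
        refine Prod.ext ?_ ?_
        · simp
          abel
        · simp
      map_smul' := fun c x => by
        apply (WithLp.equiv 2 _).injective
        refine Prod.ext ?_ ?_
        · simp
        · simp }
  involutive := fun x => by
    apply (WithLp.equiv 2 _).injective
    have hx : D.Q (x.snd : H) = 0 := D.Q_rangeQperp x.snd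
    refine Prod.ext ?_ (Subtype.ext ?_)
    · simp [coe_toPerp, D.commute, D.J.involutive, D.Q_Q, hx]
    · simp [coe_toPerp, D.commute, D.J.involutive, D.Q_Q, hx]
  inner_map := fun x y => by
    have hx : D.Q (x.snd : H) = 0 := D.Q_rangeQperp x.snd
    have hy : D.Q (y.snd : H) = 0 := D.Q_rangeQperp y.snd
    have e1 : ⟪D.Q y.fst, (x.snd : H)⟫_ℂ = 0 := by rw [D.inner_Q, hx, inner_zero_right]
    have e2 : ⟪(y.snd : H), D.Q x.fst⟫_ℂ = 0 := by rw [← D.inner_Q, hy, inner_zero_left]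
    have e3 : ⟪D.Q y.fst, D.Q x.fst⟫_ℂ = ⟪y.fst, D.Q x.fst⟫_ℂ := by rw [D.inner_Q, D.Q_Q]
    have e4 : ⟪D.Q y.fst, x.fst⟫_ℂ = ⟪y.fst, D.Q x.fst⟫_ℂ := D.inner_Q _ _
    simp only [WithLp.prod_inner_apply, Submodule.coe_inner, LinearMap.coe_mk, AddHom.coe_mk,
      coe_toPerp, D.commute, ← map_sub, ← map_add, D.J.inner_map]
    simp only [inner_add_left, inner_add_right, inner_sub_left, inner_sub_right, e1, e2, e3, e4]
    change _ = ⟪y.fst, x.fst⟫_ℂ + ⟪(y.snd : H), (x.snd : H)⟫_ℂ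
    ring

/-- The enveloping CAR algebra `CAR(H_Q, J_Q)`. -/
abbrev Env (D : GARData H) : Type (u + 1) := CAR D.JQ

/-- The Grassmann-Fermi field operators `G(f) = B(f ⊕ 0)`. -/
noncomputable def G (D : GARData H) (f : H) : D.Env := B D.JQ (WithLp.toLp 2 (f, 0))

/-- The GAR algebra: the norm-closed unital subalgebra (not star-subalgebra) of the enveloping CAR
algebra generated by the `G(f)`, `f ∈ H`. -/
noncomputable def GAR (D : GARData H) : Subalgebra ℂ D.Env :=
  (Algebra.adjoin ℂ (Set.range D.G)).topologicalClosure

/-- The Grassmann part: the norm-closed unital subalgebra generated by the `G(h)`,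
`h ∈ Q^⊥ H`. -/
noncomputable def grassmannPart (D : GARData H) : Subalgebra ℂ D.Env :=
  (Algebra.adjoin ℂ (D.G '' D.rangeQperp)).topologicalClosure

/-- The odd operators of the Grassmann part: the closed linear span of the products of an odd number
of generators `G(h)`, `h ∈ Q^⊥ H`. -/
noncomputable def grassmannOdd (D : GARData H) : Submodule ℂ D.Env :=
  (Submodule.span ℂ {a | ∃ l : List D.rangeQperp,
    Odd l.length ∧ a = (l.map fun h : D.rangeQperp => D.G (h : H)).prod}).topologicalClosure

theorem grassmannOdd_le (D : GARData H) :
    D.grassmannOdd ≤ Subalgebra.toSubmodule D.grassmannPart := by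
  have key : Submodule.span ℂ {a | ∃ l : List D.rangeQperp,
      Odd l.length ∧ a = (l.map fun h : D.rangeQperp => D.G (h : H)).prod} ≤
      Subalgebra.toSubmodule (Algebra.adjoin ℂ (D.G '' D.rangeQperp)) := by
    refine Submodule.span_le.2 ?_
    rintro _ ⟨l, -, rfl⟩
    refine list_prod_mem (S := Algebra.adjoin ℂ (D.G '' D.rangeQperp)) ?_
    intro a ha
    obtain ⟨h, -, hh⟩ := List.mem_map.1 ha
    exact Algebra.subset_adjoin ⟨(h : H), h.2, hh⟩
  exact closure_mono key

/-- The subspace of all `X` in the GAR algebra with `X λ₁ ⋯ λ_m = 0` for all families of `m` odd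
operators `λ₁, …, λ_m` in the Grassmann part. For `m = rank Q` this is the submodule that is to be
trivial. -/
noncomputable def oddNull (D : GARData H) (m : ℕ) : Submodule ℂ D.GAR where
  carrier := {X | ∀ lam : Fin m → D.Env, (∀ i, lam i ∈ D.grassmannOdd) →
    (X : D.Env) * (List.ofFn lam).prod = 0}
  add_mem' := by
    intro X Y hX hY lam hlam
    simp [add_mul, hX lam hlam, hY lam hlam]
  zero_mem' := by
    intro lam _
    simp
  smul_mem' := by
    intro c X hX lam hlam
    simp [hX lam hlam]

end GARData

end GAR

end GARAlgebra

namespace GARAlgebra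

universe u

section CAR

variable {K : Type u} [NormedAddCommGroup K] [InnerProductSpace ℂ K]

/-! A polynomial `X` in the fields involves only finitely many vectors. Since `Q^⊥ H` is
infinite-dimensional, it contains orthonormal `h`, `k` orthogonal to all of them. Put `a = G(h)` and
`v = G(k) + G(k)*`. The even unitary `u = (a + a*) v` commutes with `X` and conjugates `a` to `-a*`,
so `‖X a*‖` is controlled by `‖X a‖`. As `X = X a a* + X a* a`, this gives `‖X‖ ≤ 17 ‖X G(h)‖`
(`exists_norm_le_mul_G`).

The constant does not depend on `X`, so the estimate passes to norm limits: an element of the GAR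
algebra that kills every `G(h)`, `h ∈ Q^⊥ H`, from the left is zero (`eq_zero_of_mul_G_eq_zero`).
Peeling off one factor at a time yields the theorem, because each such `G(h)` is odd. -/

theorem norm_B_le (J : Conjugation K) (f : K) : ‖B J f‖ ≤ ‖f‖ :=
  lp.norm_le_of_forall_le (norm_nonneg f) fun r => r.norm_field_le f

theorem B_mul_eq_neg (J : Conjugation K) {f g : K} (h : ⟪J f, g⟫_ℂ = 0) :
    B J f * B J g = -(B J g * B J f) := by
  rw [eq_neg_iff_add_eq_zero, B_anticomm, h, map_zero]

/-- A field operator commutes with a product of two field operators it anticommutes with. -/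
theorem commute_B_mul_B (J : Conjugation K) {f x y : K} (hx : ⟪J f, x⟫_ℂ = 0)
    (hy : ⟪J f, y⟫_ℂ = 0) : Commute (B J f) (B J x * B J y) := by
  change B J f * (B J x * B J y) = B J x * B J y * B J f
  rw [← mul_assoc, B_mul_eq_neg J hx, neg_mul, mul_assoc, B_mul_eq_neg J hy, mul_neg, neg_neg,
    mul_assoc]

end CAR

/-- Let `a`, `a'` be adjoint fermionic modes and let `v` be an involution anticommuting with `a`.
Conjugation by the even operator `(a + a') v` exchanges `a` and `-a'`. -/
theorem conj_mode {A : Type*} [Ring A] {a a' v : A} (ha : a * a = 0) (ha' : a' * a' = 0)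
    (haa' : a * a' + a' * a = 1) (hv : v * v = 1) (hav : v * a = -(a * v)) :
    (a + a') * v * a * (v * (a + a')) = -a' := by
  have h1 : a' * a * a' = a' := by
    have h : a' * (a * a' + a' * a) = a' := by rw [haa', mul_one]
    rwa [mul_add, ← mul_assoc, ← mul_assoc, ha', zero_mul, add_zero] at h
  calc (a + a') * v * a * (v * (a + a')) = (a + a') * (v * a) * v * (a + a') := by
        simp only [mul_assoc]
    _ = -((a + a') * a * (v * v) * (a + a')) := by
        rw [hav]; simp only [mul_assoc, mul_neg, neg_mul]
    _ = -a' := by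
        rw [hv, mul_one, add_mul, ha, zero_add, mul_add, mul_assoc a' a a, ha, mul_zero, zero_add,
          h1]

/-- An operator commuting with the even operator `(a + a') v` is bounded by its product
with `a`. -/
theorem norm_le_of_commute_mode {A : Type*} [NormedRing A] {a a' v X : A} (ha : a * a = 0)
    (ha' : a' * a' = 0) (haa' : a * a' + a' * a = 1) (hv : v * v = 1) (hav : v * a = -(a * v))
    (hX : Commute X ((a + a') * v)) (na : ‖a‖ ≤ 1) (na' : ‖a'‖ ≤ 1) (nv : ‖v‖ ≤ 2) :
    ‖X‖ ≤ 17 * ‖X * a‖ := by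
  -- `X` moves past `u = (a + a') v`, and `v (a + a')` is the inverse of `u`, so `X a' = -u (X a)
  -- u⁻¹`.
  have e1 : X * a' = -((a + a') * v * (X * a) * (v * (a + a'))) := by
    have h := congrArg (fun y => -(X * y)) (conj_mode ha ha' haa' hv hav)
    simp only [mul_neg, neg_neg] at h
    rw [← h, ← mul_assoc X, ← mul_assoc X, hX.eq, mul_assoc _ X a]
  -- Triangle-inequality bounds are enough: any constant independent of `X` serves.
  have nu : ‖a + a'‖ ≤ 2 := (norm_add_le _ _).trans (by linarith)
  have n1 : ‖(a + a') * v‖ ≤ 4 := (norm_mul_le _ _).trans (by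
    nlinarith [norm_nonneg (a + a'), norm_nonneg v])
  have n2 : ‖v * (a + a')‖ ≤ 4 := (norm_mul_le _ _).trans (by
    nlinarith [norm_nonneg (a + a'), norm_nonneg v])
  have n3 : ‖X * a'‖ ≤ 16 * ‖X * a‖ := by
    rw [e1, norm_neg]
    calc _ ≤ ‖(a + a') * v‖ * ‖X * a‖ * ‖v * (a + a')‖ := norm_mul₃_le
      _ ≤ 4 * ‖X * a‖ * 4 := by gcongr
      _ = 16 * ‖X * a‖ := by ring
  have e2 : X = X * a * a' + X * a' * a := by
    rw [mul_assoc, mul_assoc, ← mul_add, haa', mul_one]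
  calc ‖X‖ = ‖X * a * a' + X * a' * a‖ := by rw [← e2]
    _ ≤ ‖X * a‖ * ‖a'‖ + ‖X * a'‖ * ‖a‖ :=
        (norm_add_le _ _).trans (add_le_add (norm_mul_le _ _) (norm_mul_le _ _))
    _ ≤ ‖X * a‖ * 1 + (16 * ‖X * a‖) * 1 := by gcongr
    _ = 17 * ‖X * a‖ := by ring

/-- An infinite-dimensional subspace contains a unit vector orthogonal to finitely many given
vectors. -/
theorem exists_unit_orthogonal {H : Type*} [NormedAddCommGroup H] [InnerProductSpace ℂ H]
    (V : Submodule ℂ H) (hV : ¬ FiniteDimensional ℂ V) (s : Finset H) :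
    ∃ h ∈ V, ‖h‖ = 1 ∧ ∀ f ∈ s, ⟪f, h⟫_ℂ = 0 := by
  let T : V →ₗ[ℂ] (s → ℂ) :=
    LinearMap.pi fun f => (innerSL ℂ (f : H)).toLinearMap ∘ₗ V.subtype
  -- An injection into the finite-dimensional space of functions on `s` would make `V`
  -- finite-dimensional. A nonzero kernel vector, normalised, is the witness.
  have hT : ¬ Function.Injective T := fun h => hV (FiniteDimensional.of_injective T h)
  rw [← LinearMap.ker_eq_bot, Submodule.eq_bot_iff] at hT
  push Not at hT
  obtain ⟨x, hx, hx0⟩ := hT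
  have hx0' : (x : H) ≠ 0 := fun h => hx0 (Subtype.ext h)
  refine ⟨((‖(x : H)‖⁻¹ : ℝ) : ℂ) • (x : H), V.smul_mem _ x.2, ?_, fun f hf => ?_⟩
  · rw [norm_smul, Complex.norm_real, norm_inv, norm_norm,
      inv_mul_cancel₀ (norm_ne_zero_iff.2 hx0')]
  · have h : ⟪f, (x : H)⟫_ℂ = 0 := congrFun (LinearMap.mem_ker.1 hx) ⟨f, hf⟩
    rw [inner_smul_right, h, mul_zero]

/-! ### Modes in `Q^⊥ H` and the annihilator of the Grassmann fields -/

namespace GARData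

variable {H : Type u} [NormedAddCommGroup H] [InnerProductSpace ℂ H] [CompleteSpace H]
  (D : GARData H)

theorem Q_of_mem {h : H} (hh : h ∈ D.rangeQperp) : D.Q h = 0 := D.Q_rangeQperp ⟨h, hh⟩

theorem inner_JQ_inl (f g : H) :
    ⟪D.JQ (WithLp.toLp 2 (f, 0)), WithLp.toLp 2 (g, 0)⟫_ℂ = ⟪D.J f, D.Q g⟫_ℂ := by
  rw [← D.inner_Q]
  simp [JQ, WithLp.prod_inner_apply]

theorem inner_inl (f g : H) :
    ⟪(WithLp.toLp 2 (f, 0) : D.HQ), WithLp.toLp 2 (g, 0)⟫_ℂ = ⟪f, g⟫_ℂ := by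
  simp [WithLp.prod_inner_apply]

theorem norm_inl (f : H) : ‖(WithLp.toLp 2 (f, 0) : D.HQ)‖ = ‖f‖ := by
  rw [@norm_eq_sqrt_re_inner ℂ, inner_inl, ← @norm_eq_sqrt_re_inner ℂ]

/-- The anticommutator of two fields only sees the `Q`-components. Hence `G(g)` with `g ∈ Q^⊥ H`
anticommutes with every `G(f)`. -/
theorem inner_JQ_inl_right_eq_zero (f : H) {g : H} (hg : g ∈ D.rangeQperp) :
    ⟪D.JQ (WithLp.toLp 2 (f, 0)), WithLp.toLp 2 (g, 0)⟫_ℂ = 0 := by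
  rw [inner_JQ_inl, D.Q_of_mem hg, inner_zero_right]

theorem inner_JQ_inl_JQ_inl (f g : H) :
    ⟪D.JQ (WithLp.toLp 2 (f, 0)), D.JQ (WithLp.toLp 2 (g, 0))⟫_ℂ = ⟪g, f⟫_ℂ :=
  (D.JQ.inner_map _ _).trans (D.inner_inl g f)

/-- The self-adjoint vector `h + J_Q h` of `H_Q`. -/
noncomputable def realPart (h : H) : D.HQ :=
  WithLp.toLp 2 (h, 0) + D.JQ (WithLp.toLp 2 (h, 0))

theorem B_realPart (h : H) : B D.JQ (D.realPart h) = D.G h + star (D.G h) := by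
  rw [realPart, map_add, G, star_B]

/-- Only the adjoint half of `G(h) + G(h)*` contributes to the anticommutator with `G(f)`, so the
two anticommute as soon as `f ⊥ h`. -/
theorem inner_JQ_realPart (f : H) {h : H} (hh : h ∈ D.rangeQperp) :
    ⟪D.JQ (WithLp.toLp 2 (f, 0)), D.realPart h⟫_ℂ = ⟪h, f⟫_ℂ := by
  rw [realPart, inner_add_right, D.inner_JQ_inl_right_eq_zero f hh, inner_JQ_inl_JQ_inl, zero_add]

theorem norm_G_le (f : H) : ‖D.G f‖ ≤ ‖f‖ :=
  (norm_B_le _ _).trans (D.norm_inl f).le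

theorem G_mul_self {h : H} (hh : h ∈ D.rangeQperp) : D.G h * D.G h = 0 := by
  have h1 := B_mul_eq_neg D.JQ (D.inner_JQ_inl_right_eq_zero h hh)
  have h2 : (2 : ℂ) • (D.G h * D.G h) = 0 := by
    rw [two_smul]
    exact eq_neg_iff_add_eq_zero.1 h1
  exact (smul_eq_zero.1 h2).resolve_left two_ne_zero

theorem G_mul_star_add (f : H) :
    D.G f * star (D.G f) + star (D.G f) * D.G f = algebraMap ℂ D.Env ⟪f, f⟫_ℂ := by
  rw [G, star_B, B_anticomm, inner_JQ_inl_JQ_inl]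

/-- An element of the dense polynomial subalgebra only involves finitely many vectors, hence
commutes with the even operators of modes orthogonal to them. -/
theorem exists_finset_commute {X : D.Env} (hX : X ∈ Algebra.adjoin ℂ (Set.range D.G)) :
    ∃ s : Finset H, ∀ h ∈ D.rangeQperp, ∀ k ∈ D.rangeQperp, (∀ f ∈ s, ⟪f, h⟫_ℂ = 0) →
      (∀ f ∈ s, ⟪f, k⟫_ℂ = 0) →
      Commute X (B D.JQ (D.realPart h) * B D.JQ (D.realPart k)) := by
  classical
  induction hX using Algebra.adjoin_induction with
  | mem x hx =>
    obtain ⟨f, rfl⟩ := hx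
    refine ⟨{f}, fun h hh k hk hs ks => commute_B_mul_B _ ?_ ?_⟩
    · rw [D.inner_JQ_realPart f hh, inner_eq_zero_symm]
      exact hs f (Finset.mem_singleton_self f)
    · rw [D.inner_JQ_realPart f hk, inner_eq_zero_symm]
      exact ks f (Finset.mem_singleton_self f)
  | algebraMap c => exact ⟨∅, fun _ _ _ _ _ _ => Algebra.commute_algebraMap_left c _⟩
  | add x y _ _ hx hy =>
    obtain ⟨s, hs⟩ := hx
    obtain ⟨t, ht⟩ := hy
    exact ⟨s ∪ t, fun h hh k hk h1 h2 =>
      (hs h hh k hk (fun f hf => h1 f (Finset.mem_union_left t hf))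
        (fun f hf => h2 f (Finset.mem_union_left t hf))).add_left
      (ht h hh k hk (fun f hf => h1 f (Finset.mem_union_right s hf))
        (fun f hf => h2 f (Finset.mem_union_right s hf)))⟩
  | mul x y _ _ hx hy =>
    obtain ⟨s, hs⟩ := hx
    obtain ⟨t, ht⟩ := hy
    exact ⟨s ∪ t, fun h hh k hk h1 h2 =>
      (hs h hh k hk (fun f hf => h1 f (Finset.mem_union_left t hf))
        (fun f hf => h2 f (Finset.mem_union_left t hf))).mul_left
      (ht h hh k hk (fun f hf => h1 f (Finset.mem_union_right s hf))
        (fun f hf => h2 f (Finset.mem_union_right s hf)))⟩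

/-- For `X` a polynomial in the fields there is a unit vector `h` in `Q^⊥ H` such that right
multiplication by `G(h)` is bounded below at `X`, uniformly. -/
theorem exists_norm_le_mul_G (hD : ¬ FiniteDimensional ℂ D.rangeQperp) {X : D.Env}
    (hX : X ∈ Algebra.adjoin ℂ (Set.range D.G)) :
    ∃ h ∈ D.rangeQperp, ‖h‖ = 1 ∧ ‖X‖ ≤ 17 * ‖X * D.G h‖ := by
  classical
  obtain ⟨s, hs⟩ := D.exists_finset_commute hX
  obtain ⟨h, hh, nh, oh⟩ := exists_unit_orthogonal D.rangeQperp hD s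
  -- Orthogonality of `k` to `h` as well makes `v = G(k) + G(k)*` anticommute with `G(h)`; the
  -- second mode serves to make `u` even.
  obtain ⟨k, hk, nk, ok⟩ := exists_unit_orthogonal D.rangeQperp hD (insert h s)
  have hkh : ⟪k, h⟫_ℂ = 0 := inner_eq_zero_symm.1 (ok h (Finset.mem_insert_self h s))
  have one_of_unit : ∀ f : H, ‖f‖ = 1 →
      D.G f * star (D.G f) + star (D.G f) * D.G f = 1 := fun f hf => by
    rw [G_mul_star_add, inner_self_eq_norm_sq_to_K, hf]
    simp
  have star_mul_self_zero : ∀ f ∈ D.rangeQperp, star (D.G f) * star (D.G f) = 0 := fun f hf => by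
    rw [← star_mul, D.G_mul_self hf, star_zero]
  have na : ‖D.G h‖ ≤ 1 := nh ▸ D.norm_G_le h
  have nb : ‖D.G k‖ ≤ 1 := nk ▸ D.norm_G_le k
  refine ⟨h, hh, nh, norm_le_of_commute_mode (a' := star (D.G h)) (v := D.G k + star (D.G k))
    (D.G_mul_self hh) (star_mul_self_zero h hh) (one_of_unit h nh) ?_ ?_ ?_ na ?_ ?_⟩
  · rw [add_mul, mul_add, mul_add, D.G_mul_self hk, star_mul_self_zero k hk, zero_add, add_zero,
      one_of_unit k nk]
  · rw [← B_realPart, eq_neg_iff_add_eq_zero, add_comm]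
    change B D.JQ (WithLp.toLp 2 (h, 0)) * _ + _ * B D.JQ (WithLp.toLp 2 (h, 0)) = 0
    rw [B_anticomm, D.inner_JQ_realPart h hk, hkh, map_zero]
  · rw [← B_realPart, ← B_realPart]
    exact hs h hh k hk oh fun f hf => ok f (Finset.mem_insert_of_mem hf)
  · rwa [norm_star]
  · refine (norm_add_le _ _).trans ?_
    rw [norm_star]
    linarith

/-- The fields `G(h)`, `h ∈ Q^⊥ H`, have no common left annihilator in the GAR algebra if `Q^⊥` has
infinite rank. -/
theorem eq_zero_of_mul_G_eq_zero (hD : ¬ FiniteDimensional ℂ D.rangeQperp) {X : D.Env}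
    (hX : X ∈ D.GAR) (h0 : ∀ h ∈ D.rangeQperp, X * D.G h = 0) : X = 0 := by
  refine norm_le_zero_iff.1 (le_of_forall_pos_le_add fun ε hε => ?_)
  have hX' : X ∈ closure (Algebra.adjoin ℂ (Set.range D.G) : Set D.Env) := hX
  -- Since `X G(h) = 0`, the bound on `Y` gives `‖Y‖ ≤ 17 ‖X - Y‖`, hence `‖X‖ ≤ 18 ‖X - Y‖`.
  obtain ⟨Y, hY, hXY⟩ := Metric.mem_closure_iff.1 hX' (ε / 18) (by positivity)
  rw [dist_eq_norm] at hXY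
  obtain ⟨h, hh, nh, hle⟩ := D.exists_norm_le_mul_G hD hY
  have e : Y * D.G h = -((X - Y) * D.G h) := by rw [sub_mul, h0 h hh, zero_sub, neg_neg]
  have n1 : ‖Y * D.G h‖ ≤ ‖X - Y‖ := by
    rw [e, norm_neg]
    refine (norm_mul_le _ _).trans (mul_le_of_le_one_right (norm_nonneg _) ?_)
    exact nh ▸ D.norm_G_le h
  have n2 : ‖X‖ ≤ ‖X - Y‖ + ‖Y‖ := by simpa using norm_add_le (X - Y) Y
  linarith

theorem G_mem_GAR (f : H) : D.G f ∈ D.GAR :=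
  Subalgebra.le_topologicalClosure _ (Algebra.subset_adjoin (Set.mem_range_self f))

theorem G_mem_grassmannOdd {h : H} (hh : h ∈ D.rangeQperp) : D.G h ∈ D.grassmannOdd :=
  Submodule.le_topologicalClosure _ (Submodule.subset_span ⟨[⟨h, hh⟩], by simp, by simp⟩)

theorem eq_zero_of_mul_ofFn_G_eq_zero (hD : ¬ FiniteDimensional ℂ D.rangeQperp) (m : ℕ)
    {X : D.Env} (hX : X ∈ D.GAR)
    (h0 : ∀ h : Fin m → H, (∀ i, h i ∈ D.rangeQperp) →
      X * (List.ofFn fun i => D.G (h i)).prod = 0) : X = 0 := by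
  induction m generalizing X with
  | zero => simpa using h0 Fin.elim0 fun i => i.elim0
  | succ m ih =>
    -- `X G(h)` lies again in the GAR algebra and is annihilated by all products of `m` factors, so
    -- it vanishes by induction for every `h`.
    refine D.eq_zero_of_mul_G_eq_zero hD hX fun h hh =>
      ih (mul_mem hX (D.G_mem_GAR h)) fun k hk => ?_
    have := h0 (Fin.cons h k) (Fin.cases hh hk)
    simpa [List.ofFn_succ, mul_assoc] using this

end GARData

end GARAlgebra

theorem mainTheorem8 {H : Type*} [NormedAddCommGroup H] [InnerProductSpace ℂ H] [CompleteSpace H]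
    [TopologicalSpace.SeparableSpace H] (D : GARAlgebra.GARData H) (n : ℕ)
    (hQ_finite : FiniteDimensional ℂ D.rangeQ)
    (hQ_rank : Module.finrank ℂ D.rangeQ = 2 * n)
    (hQperp : ¬ FiniteDimensional ℂ D.rangeQperp) :
    D.oddNull (2 * n) = ⊥ := by
  refine (Submodule.eq_bot_iff _).2 fun X hX => Subtype.ext ?_
  exact D.eq_zero_of_mul_ofFn_G_eq_zero hQperp (2 * n) X.2 fun h hh =>
    hX _ fun i => D.G_mem_grassmannOdd (hh i)
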